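/- Let $(\mathcal Z,\Sigma,\mu)$ be a probability space, let $L:\mathcal Z\to\mathbb R$ be any function (for instance the loss $L\hat y_{\mathcal A(S)}$ of a model learned from a training set $S$), let $m\ge 1$, $d\ge 0$ be integers, and let $Z=(z_1,\dots,z_m)\in\mathcal Z^m$ be any dataset (for instance $Z=S$). Write $\hat{\mathbb E}_Z[L]=\frac1m\sum_{i=1}^m L(z_i)$ and $\mathbb E_\mu[L]=\int_{\mathcal Z}L\,d\mu$. For $a\le b$ in $[0,1]^d$ (componentwise order) let $[a,b]=\{t\in[0,1]^d: a\le t\le b\}$, and write $\mathbf 0=(0,\dots,0)$, $\mathbf 1=(1,\dots,1)$. For a function $g:[0,1]^J\to\mathbb R$ on a finite nonempty set $J$ of coordinates, its Vitali variation is $V^{J}[g]=\sup_P\sum_{c}|\Delta_c g|$, where $P$ ranges over the partitions of $[0,1]^J$ given by one finite sequence $0=t_j^{(0)}\le\dots\le t_j^{(n_j)}=1$ per coordinate $j\in J$, $c$ over the cells of $P$, and $\Delta_c g$ is the iterated difference of $g$ over the cell $c$ (the alternating sum of $g$ over its corners). For $f:[0,1]^d\to\mathbb R$ the Hardy–Krause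 variation is $V[f]=\sum_{\emptyset\ne J\subseteq\{1,\dots,d\}}V^{J}[f_J]\in[0,\infty]$, where $f_J$ is $f$ with every variable outside $J$ fixed to $1$. For a probability measure $\rho$ on $[0,1]^d$ and points $p_1,\dots,p_m\in[0,1]^d$, the star-discrepancy is $D^*[\rho,p]=\sup_{t\in[0,1]^d}\bigl|\frac1m\sum_{i}\mathbf 1_{[\mathbf 0,t]}(p_i)-\rho([\mathbf 0,t])\bigr|$. Let $\mathcal F$ be the set of pairs $(T,f)$ such that $T:\mathcal Z\to[0,1]^d$ is measurable, $f:[0,1]^d\to\mathbb R$ satisfies $V[f]<\infty$, and $L(z)=f(T(z))$ for all $z\in\mathcal Z$. If $\mathcal F\neq\emptyset$, then $L$ is $\mu$-integrable, and: (i) $$\mathbb E_\mu[L]\ \le\ \hat{\mathbb E}_Z[L]+\inf_{(T,f)\in\mathcal F}V[f]\;D^*[T_*\mu,T(Z)],$$ where $T(Z)=(T(z_1),\dots,T(z_m))$ (for $\mathcal F=\emptyset$ the infimum is $+\infty$ and the bound is void). (ii) For every $(T,f)\in\mathcal F$ such that $f$ is left-continuous in each variable separately at every point, there is a finite signed Borel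 measure $\nu_f$ on $[0,1]^d$ with $f(t)=\nu_f([t,\mathbf 1])+f(\mathbf 1)$ for all $t\in[0,1]^d$ and $|\nu_f|([0,1]^d)=V[f]$, and $$\mathbb E_\mu[L]=\hat{\mathbb E}_Z[L]+\int_{[0,1]^d}\Bigl((T_*\mu)([\mathbf 0,t])-\frac1m\sum_{i=1}^m\mathbf 1_{[\mathbf 0,t]}(T(z_i))\Bigr)\,d\nu_f(t),$$ the integrand being $|\nu_f|$-integrable. -/

import Mathlib

open MeasureTheory Set
open scoped ENNReal unitInterval

noncomputable section

namespace AnalyticalLearning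

/-- A finite sequence `0 = t⁽⁰⁾ ≤ t⁽¹⁾ ≤ ⋯ ≤ t⁽ᵐ⁾ = 1` in `[0,1]`, with `m = size`. -/
structure Subdivision where
  size : ℕ
  pts : Fin (size + 1) → I
  mono : Monotone pts
  first : pts 0 = 0
  last : pts (Fin.last size) = 1

/-- The iterated difference `Δ₁ ⋯ Δₖ g` over the box with lower corner `a` and upper corner `b`,
where `Δⱼ` replaces the `j`-th coordinate by `b j`, then by `a j`, and subtracts; written out as
the alternating sum of `g` over the corners of the box. -/
def boxDiff {ι : Type*} [Fintype ι] [DecidableEq ι] (g : (ι → I) → ℝ) (a b : ι → I) : ℝ :=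
  ∑ s : Finset ι, (-1 : ℝ) ^ (Fintype.card ι - s.card) * g (fun j => if j ∈ s then b j else a j)

/-- The variation in the sense of Vitali of a function `g` on `[0,1]^ι`: the supremum, over all
partitions of `[0,1]^ι` (one subdivision for each coordinate), of the sum over all cells of the
absolute values of the iterated differences. -/
def vitaliVariation {ι : Type*} [Fintype ι] [DecidableEq ι] (g : (ι → I) → ℝ) : ℝ≥0∞ :=
  ⨆ P : ι → Subdivision, ∑ i : ((j : ι) → Fin (P j).size),
    ENNReal.ofReal |boxDiff g (fun j => (P j).pts (i j).castSucc) (fun j => (P j).pts (i j).succ)|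

/-- The function of the variables in `J` obtained from `f` by fixing all other variables to `1`. -/
def restrictFace {d : ℕ} (f : (Fin d → I) → ℝ) (J : Finset (Fin d)) : (J → I) → ℝ :=
  fun u => f (fun j => if h : j ∈ J then u ⟨j, h⟩ else 1)

/-- The variation of `f` on `[0,1]^d` in the sense of Hardy and Krause. -/
def hardyKrause {d : ℕ} (f : (Fin d → I) → ℝ) : ℝ≥0∞ :=
  ∑ J : Finset (Fin d) with J.Nonempty, vitaliVariation (restrictFace f J)

/-- The fraction of the points `t⁽¹⁾, …, t⁽ᵐ⁾` that lie in the set `B`. -/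
def empiricalFraction {d m : ℕ} (p : Fin m → Fin d → I) (B : Set (Fin d → I)) : ℝ :=
  (1 / (m : ℝ)) * ∑ i, B.indicator (fun _ => (1 : ℝ)) (p i)

/-- The local discrepancy of the dataset `p` with respect to `ρ` on the box `[0,t]`. -/
def localDiscrepancy {d m : ℕ} (p : Fin m → Fin d → I) (ρ : Measure (Fin d → I))
    (t : Fin d → I) : ℝ :=
  empiricalFraction p (Icc 0 t) - ρ.real (Icc 0 t)

/-- The star-discrepancy of the dataset `p` with respect to `ρ`. -/
def starDiscrepancy {d m : ℕ} (p : Fin m → Fin d → I) (ρ : Measure (Fin d → I)) : ℝ≥0∞ :=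
  ⨆ t : Fin d → I, ENNReal.ofReal |localDiscrepancy p ρ t|

/-- The pairs `(T, f)` with `T` a measurable map into `[0,1]^d`, `f` of bounded variation in the
sense of Hardy and Krause, and `L = f ∘ T`. -/
def factorizations {Z : Type*} [MeasurableSpace Z] (d : ℕ) (L : Z → ℝ) :
    Set ((Z → Fin d → I) × ((Fin d → I) → ℝ)) :=
  {p | Measurable p.1 ∧ hardyKrause p.2 < ∞ ∧ ∀ z, L z = p.2 (p.1 z)}

/-- `f` is left-continuous in each variable, at every point. -/
def LeftContinuousComponentwise {d : ℕ} (f : (Fin d → I) → ℝ) : Prop :=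
  ∀ (t : Fin d → I) (j : Fin d),
    ContinuousWithinAt (fun s : I => f (Function.update t j s)) (Iic (t j)) (t j)

/-- The empirical error of `L` on the dataset `z`. -/
def empiricalError {Z : Type*} {m : ℕ} (L : Z → ℝ) (z : Fin m → Z) : ℝ :=
  (1 / (m : ℝ)) * ∑ i, L (z i)

end AnalyticalLearning

end

namespace AnalyticalLearning

open Filter Topology

/-! Up to the constant `f 1`, a function of finite Hardy–Krause variation behaves like t ↦ ν([t,1])
for a signed measure ν of total mass at most V[f]. Both claims then come from Fubini, ∫ ν([x,1])
dρ(x) = ∫ ρ([0,t]) dν(t), used for ρ = T_*μ and for the empirical measure.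

On a finite grid the representation is exact (`exists_grid_measures`): the half-open cells of all
the faces {u_j = 1 for j ∉ J} partition the cube, and the mass of a cell is, up to sign, the
iterated difference of f over it.

Without continuity no single ν need represent f. For (i), f is therefore approximated uniformly by
step functions f ∘ q with q monotone in each coordinate (`exists_step_approx`), which also makes f
measurable. A step function sees only a finite grid, and {q x ≤ t} is a product of lower sets, so
the star-discrepancy still controls it (`abs_sub_real_lower_le`).

For (ii), the grid measures have weak limits by compactness (`exists_limit_measures`), and
left-continuity recovers f from them. The mass bound survives the limit; conversely, disjoint cells
show that the total variation is at least V[f] (`hardyKrause_le_variation`). -/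

/-! ### Face boxes and alternating sums over their corners -/

/-- The point with coordinates `v` on the face `J` and `1` elsewhere. -/
def faceExtend {d : ℕ} (J : Finset (Fin d)) (v : J → I) : Fin d → I :=
  fun j => if h : j ∈ J then v ⟨j, h⟩ else 1

/-- The half-open box `[a, b)` inside the face of `[0,1]^d` where the coordinates outside `J`
equal `1`. -/
def faceBox {d : ℕ} (J : Finset (Fin d)) (a b : J → I) : Set (Fin d → I) :=
  {u | (∀ j : J, a j ≤ u j ∧ u j < b j) ∧ ∀ j ∉ J, u j = 1}

lemma faceExtend_le_iff {d : ℕ} (J : Finset (Fin d)) (v : J → I) (u : Fin d → I) :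
    faceExtend J v ≤ u ↔ (∀ j : J, v j ≤ u j) ∧ ∀ j ∉ J, u j = 1 := by
  simp only [Pi.le_def, faceExtend]
  constructor
  · intro h
    refine ⟨fun j => by simpa using h j, fun j hj => ?_⟩
    have := h j
    rw [dif_neg hj] at this
    exact le_antisymm unitInterval.le_one' this
  · rintro ⟨h1, h2⟩ j
    by_cases hj : j ∈ J
    · simpa [hj] using h1 ⟨j, hj⟩
    · simp [hj, h2 j hj]

/-- On the face, the indicator is the product over `J` of 1_{a_j ≤ u_j} − 1_{b_j ≤ u_j}; expanding
the product gives the sum over corners. Off the face both sides vanish, since every corner has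
coordinates 1 outside `J`. -/
lemma indicator_faceBox {d : ℕ} (J : Finset (Fin d)) (a b : J → I) (hab : a ≤ b)
    (u : Fin d → I) :
    (faceBox J a b).indicator (fun _ => (1 : ℝ)) u =
      ∑ s : Finset J, (-1 : ℝ) ^ s.card *
        (Ici (faceExtend J fun j => if j ∈ s then b j else a j)).indicator (fun _ => (1 : ℝ)) u := by
  classical
  by_cases hu : ∀ j ∉ J, u j = 1
  · have hL : (faceBox J a b).indicator (fun _ => (1 : ℝ)) u =
        ∏ j : J, (-(if b j ≤ u j then (1 : ℝ) else 0) + (if a j ≤ u j then (1 : ℝ) else 0)) := by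
      have h1 : ∀ j : J, (-(if b j ≤ u j then (1 : ℝ) else 0) + (if a j ≤ u j then (1 : ℝ) else 0))
          = if a j ≤ u j ∧ u j < b j then 1 else 0 := by
        intro j
        by_cases h : b j ≤ u j
        · simp [h, (hab j).trans h, not_lt.2 h]
        · simp [h, not_le.1 h]
      simp_rw [h1]
      by_cases h : ∀ j : J, a j ≤ u j ∧ u j < b j
      · rw [Finset.prod_congr rfl (fun j _ => if_pos (h j))]
        rw [indicator_of_mem (show u ∈ faceBox J a b from ⟨h, hu⟩)]
        simp
      · rw [indicator_of_notMem (fun hh => h hh.1)]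
        push Not at h
        obtain ⟨j, hj⟩ := h
        refine (Finset.prod_eq_zero (Finset.mem_univ j) ?_).symm
        rw [if_neg]
        intro h'
        exact absurd h'.2 (not_lt.2 (hj h'.1))
    rw [hL, Finset.prod_add, Finset.powerset_univ]
    refine Finset.sum_congr rfl fun s _ => ?_
    rw [Finset.prod_neg, mul_assoc]
    congr 1
    by_cases h : ∀ j : J, (if j ∈ s then b j else a j) ≤ u j
    · rw [indicator_of_mem (show u ∈ Ici _ from (faceExtend_le_iff _ _ _).2 ⟨h, hu⟩)]
      rw [Finset.prod_eq_one, Finset.prod_eq_one, one_mul]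
      · intro j hj
        have := h j
        rw [if_neg (Finset.mem_sdiff.1 hj).2] at this
        exact if_pos this
      · intro j hj
        have := h j
        rw [if_pos hj] at this
        exact if_pos this
    · rw [indicator_of_notMem (fun hh => h ((faceExtend_le_iff _ _ _).1 hh).1)]
      push Not at h
      obtain ⟨j, hj⟩ := h
      by_cases hjs : j ∈ s
      · rw [Finset.prod_eq_zero hjs, zero_mul]
        rw [if_pos hjs] at hj
        exact if_neg (not_le.2 hj)
      · rw [mul_eq_zero_of_right]
        refine Finset.prod_eq_zero (i := j) (by simp [hjs]) ?_
        rw [if_neg hjs] at hj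
        exact if_neg (not_le.2 hj)
  · rw [indicator_of_notMem (fun h => hu h.2), Finset.sum_eq_zero]
    intro s _
    rw [indicator_of_notMem (fun hh => hu ((faceExtend_le_iff _ _ _).1 hh).2), mul_zero]

lemma faceExtend_empty {d : ℕ} (v : (∅ : Finset (Fin d)) → I) : faceExtend ∅ v = 1 := by
  funext j; simp [faceExtend]

/-- The alternating sum over the corners of a face box of `f - f 1`. -/
lemma abs_sum_corners {d : ℕ} (f : (Fin d → I) → ℝ) (J : Finset (Fin d)) (a b : J → I) :
    |∑ s : Finset J, (-1 : ℝ) ^ s.card *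
        (f (faceExtend J fun j => if j ∈ s then b j else a j) - f 1)| =
      if J.Nonempty then |boxDiff (restrictFace f J) a b| else 0 := by
  classical
  split_ifs with hJ
  -- The constant `f 1` cancels because `J` is nonempty; what remains differs from `boxDiff` by the
  -- global sign (-1)^|J|.
  · have h0 : ∑ s : Finset J, (-1 : ℝ) ^ s.card = 0 := by
      have := Finset.sum_powerset_neg_one_pow_card_of_nonempty (x := (Finset.univ : Finset J))
        (by simpa using hJ)
      rw [Finset.powerset_univ] at this
      exact_mod_cast this
    have h1 : ∑ s : Finset J, (-1 : ℝ) ^ s.card *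
        (f (faceExtend J fun j => if j ∈ s then b j else a j) - f 1) =
        (-1) ^ Fintype.card J * boxDiff (restrictFace f J) a b := by
      simp_rw [mul_sub, Finset.sum_sub_distrib, ← Finset.sum_mul, h0, zero_mul, sub_zero]
      rw [boxDiff, Finset.mul_sum]
      refine Finset.sum_congr rfl fun s _ => ?_
      rw [← mul_assoc, ← pow_add]
      have hs : s.card ≤ Fintype.card J := Finset.card_le_univ s
      congr 1
      obtain ⟨k, hk⟩ := Nat.exists_eq_add_of_le hs
      rw [hk, show s.card + k + (s.card + k - s.card) = s.card + 2 * k by omega, pow_add, pow_mul]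
      simp
    rw [h1, abs_mul, abs_pow]
    simp
  · rw [Finset.not_nonempty_iff_eq_empty] at hJ
    subst hJ
    simp_rw [faceExtend_empty]
    simp

/-! ### Exact representation of `f` on finite grids -/

/-- The indicator functions of the boxes `[t, 1]` are linearly independent. -/
lemma linearIndependent_indicator_Ici (X : Type*) [PartialOrder X] :
    LinearIndependent ℝ (fun t : X => (Ici t).indicator (fun _ => (1 : ℝ))) := by
  classical
  rw [linearIndependent_iff']
  intro s g hg i hi
  by_contra hne
  -- Evaluated at a minimal index with nonzero coefficient, the relation retains only that index.
  obtain ⟨t, ht⟩ := (s.filter fun t => g t ≠ 0).exists_minimal ⟨i, by simp [hi, hne]⟩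
  have hts := Finset.mem_filter.1 ht.1
  apply hts.2
  have := congrFun hg t
  rw [Finset.sum_apply, Finset.sum_eq_single t] at this
  · simpa using this
  · intro t' ht' hne'
    by_cases h0 : g t' = 0
    · simp [h0]
    · rw [Pi.smul_apply, indicator_of_notMem, smul_zero]
      intro hle
      exact hne' (le_antisymm hle (ht.2 (Finset.mem_filter.2 ⟨ht', h0⟩) hle))
  · intro h; exact absurd hts.1 h

/-- Such a purely algebraic functional turns any finite linear identity between indicators into the
same identity between values of `g`. -/
lemma exists_linearMap_indicator_Ici {X : Type*} [PartialOrder X] (g : X → ℝ) :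
    ∃ Φ : (X → ℝ) →ₗ[ℝ] ℝ, ∀ t, Φ ((Ici t).indicator fun _ => 1) = g t := by
  obtain ⟨Φ, hΦ⟩ := LinearMap.exists_extend
    ((Module.Basis.span (linearIndependent_indicator_Ici X)).constr ℝ g)
  refine ⟨Φ, fun t => ?_⟩
  have := LinearMap.congr_fun hΦ (Module.Basis.span (linearIndependent_indicator_Ici X) t)
  rw [Module.Basis.constr_basis] at this
  rw [← this, LinearMap.comp_apply, Submodule.subtype_apply, Module.Basis.span_apply]

lemma Subdivision.exists_mem_Ico (P : Subdivision) {s : I} (hs : s < 1) :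
    ∃ i : Fin P.size, P.pts i.castSucc ≤ s ∧ s < P.pts i.succ := by
  by_contra! h
  have : ∀ i : Fin (P.size + 1), P.pts i ≤ s := by
    intro i
    induction i using Fin.induction with
    | zero => rw [P.first]; exact unitInterval.nonneg'
    | succ i ih => exact h i ih
  exact absurd (this (Fin.last _)) (by rw [P.last]; exact not_le.2 hs)

lemma Subdivision.eq_of_mem_Ico (P : Subdivision) {s : I} {i k : Fin P.size}
    (hi : P.pts i.castSucc ≤ s ∧ s < P.pts i.succ) (hk : P.pts k.castSucc ≤ s ∧ s < P.pts k.succ) :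
    i = k := by
  by_contra hne
  wlog h : i < k generalizing i k
  · exact this hk hi (Ne.symm hne) (lt_of_le_of_ne (not_lt.1 h) (Ne.symm hne))
  have : i.succ ≤ k.castSucc := by
    rw [Fin.le_def]; simpa using h
  exact absurd (hi.2.trans_le ((P.mono this).trans hk.1)) (lt_irrefl _)

lemma Subdivision.exists_range_supset (A : Finset I) :
    ∃ P : Subdivision, ∀ a ∈ A, a ∈ range P.pts := by
  classical
  set B : Finset I := insert 0 (insert 1 A) with hB
  have hpos : 0 < B.card := Finset.card_pos.2 ⟨0, by simp [hB]⟩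
  obtain ⟨n, hn⟩ := Nat.exists_eq_succ_of_ne_zero hpos.ne'
  have hr := Finset.range_orderEmbOfFin B hn
  refine ⟨⟨n, B.orderEmbOfFin hn, (B.orderEmbOfFin hn).monotone, ?_, ?_⟩, ?_⟩
  · obtain ⟨i, hi⟩ : (0 : I) ∈ range (B.orderEmbOfFin hn) := by rw [hr]; simp [hB]
    refine le_antisymm ?_ unitInterval.nonneg'
    rw [← hi]
    exact (B.orderEmbOfFin hn).monotone (Fin.zero_le i)
  · obtain ⟨i, hi⟩ : (1 : I) ∈ range (B.orderEmbOfFin hn) := by rw [hr]; simp [hB]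
    refine le_antisymm unitInterval.le_one' ?_
    rw [← hi]
    exact (B.orderEmbOfFin hn).monotone (Fin.le_last i)
  · intro a ha
    show a ∈ range (B.orderEmbOfFin hn)
    rw [hr]; simp [hB, ha]

/-- For grid points `x`, [x,1] is a disjoint union of cells of faces, so the functional sending
1_{[t,1]} to `f t - f 1` gives the formula, with its value on a cell's indicator as weight. The face
`J = ∅` is the single point 1, of weight 0. -/
lemma exists_grid_weights {d : ℕ} (f : (Fin d → I) → ℝ) (A : Finset I) :
    ∃ (P : Subdivision) (w : (J : Finset (Fin d)) → (J → Fin P.size) → ℝ),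
      (∀ J i, |w J i| = if J.Nonempty then |boxDiff (restrictFace f J)
        (fun j => P.pts (i j).castSucc) (fun j => P.pts (i j).succ)| else 0) ∧
      ∀ x : Fin d → I, (∀ j, x j ∈ A) → f x - f 1 = ∑ J : Finset (Fin d), ∑ i : J → Fin P.size, w J i *
        (Ici x).indicator (fun _ => (1 : ℝ)) (faceExtend J fun j => P.pts (i j).castSucc) := by
  classical
  obtain ⟨P, hP⟩ := Subdivision.exists_range_supset A
  obtain ⟨Φ, hΦ⟩ := exists_linearMap_indicator_Ici (fun t : Fin d → I => f t - f 1)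
  set cell : (J : Finset (Fin d)) → (J → Fin P.size) → Set (Fin d → I) := fun J i =>
    faceBox J (fun j => P.pts (i j).castSucc) (fun j => P.pts (i j).succ)
  refine ⟨P, fun J i => Φ ((cell J i).indicator fun _ => 1), fun J i => ?_, fun x hx => ?_⟩
  · have : (cell J i).indicator (fun _ => (1 : ℝ)) = ∑ s : Finset J, (-1 : ℝ) ^ s.card •
        (Ici (faceExtend J fun j => if j ∈ s then P.pts (i j).succ else P.pts (i j).castSucc)).indicator
          (fun _ => (1 : ℝ)) := by
      funext u
      rw [indicator_faceBox J _ _ (fun j => P.mono (Fin.castSucc_le_succ _)), Finset.sum_apply]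
      rfl
    beta_reduce
    rw [this, map_sum]
    simp_rw [map_smul, hΦ, smul_eq_mul]
    exact abs_sum_corners f J _ _
  · rw [← hΦ x]
    have : (Ici x).indicator (fun _ => (1 : ℝ)) = ∑ J : Finset (Fin d), ∑ i : J → Fin P.size,
        (Ici x).indicator (fun _ => (1 : ℝ)) (faceExtend J fun j => P.pts (i j).castSucc) •
          (cell J i).indicator fun _ => (1 : ℝ) := by
      funext u
      simp only [Finset.sum_apply, Pi.smul_apply, smul_eq_mul]
      -- The coordinates of `u` below 1 single out its face; on that face the half-open cells
      -- determine `i₀`.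
      set J₀ : Finset (Fin d) := Finset.univ.filter fun j => u j < 1 with hJ₀
      have hlt : ∀ j : J₀, u j < 1 := fun j => (Finset.mem_filter.1 j.2).2
      have hone : ∀ j ∉ J₀, u j = 1 := fun j hj => by
        refine le_antisymm unitInterval.le_one' (not_lt.1 fun h => hj ?_)
        simp [hJ₀, h]
      choose i₀ hi₀ using fun j : J₀ => P.exists_mem_Ico (hlt j)
      rw [Finset.sum_eq_single J₀, Finset.sum_eq_single i₀]
      · rw [indicator_of_mem (show u ∈ cell J₀ i₀ from ⟨hi₀, hone⟩), mul_one]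
        -- As each `x j` is a subdivision point, it cannot lie strictly between the lower corner of
        -- the cell and `u`.
        have : u ∈ Ici x ↔ (faceExtend J₀ fun j => P.pts (i₀ j).castSucc) ∈ Ici x := by
          constructor
          · intro hu j
            by_cases hj : j ∈ J₀
            · obtain ⟨k, hk⟩ := hP _ (hx j)
              simp only [faceExtend, hj, dite_true]
              rw [← hk]
              refine P.mono (not_lt.1 fun h => ?_)
              have h2 : (i₀ ⟨j, hj⟩).succ ≤ k := Fin.castSucc_lt_iff_succ_le.1 h
              have := (hi₀ ⟨j, hj⟩).2.trans_le (P.mono h2)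
              rw [hk] at this
              exact absurd this (not_lt.2 (hu j))
            · simp only [faceExtend, hj, dite_false]
              exact unitInterval.le_one'
          · intro h
            exact le_trans h ((faceExtend_le_iff _ _ _).2 ⟨fun j => (hi₀ j).1, hone⟩)
        by_cases h : u ∈ Ici x
        · rw [indicator_of_mem h, indicator_of_mem (this.1 h)]
        · rw [indicator_of_notMem h, indicator_of_notMem (fun h' => h (this.2 h'))]
      · intro i _ hi
        refine mul_eq_zero_of_right _ (indicator_of_notMem ?_ _)
        intro hu
        exact hi (funext fun j => P.eq_of_mem_Ico (hu.1 j) (hi₀ j))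
      · simp
      · intro J _ hJ
        refine Finset.sum_eq_zero fun i _ => ?_
        refine mul_eq_zero_of_right _ (indicator_of_notMem ?_ _)
        intro hu
        apply hJ
        ext j
        constructor
        · intro hj
          have := (hu.1 ⟨j, hj⟩).2.trans_le unitInterval.le_one'
          simpa [hJ₀] using this
        · intro hj
          by_contra h
          exact absurd (hu.2 j h) (hlt ⟨j, hj⟩).ne
      · simp
    conv_lhs => rw [this]
    simp_rw [map_sum, map_smul, smul_eq_mul]
    exact Finset.sum_congr rfl fun J _ => Finset.sum_congr rfl fun i _ => mul_comm _ _

/-- The positive and negative parts of the weights are placed as point masses at the lower corners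
of the cells. -/
lemma exists_grid_measures {d : ℕ} (f : (Fin d → I) → ℝ) (A : Finset I) :
    ∃ μ ν : FiniteMeasure (Fin d → I),
      (μ : Measure (Fin d → I)) univ + (ν : Measure (Fin d → I)) univ ≤ hardyKrause f ∧
      ∀ x : Fin d → I, (∀ j, x j ∈ A) →
        f x - f 1 = (μ : Measure (Fin d → I)).real (Ici x) - (ν : Measure _).real (Ici x) := by
  classical
  obtain ⟨P, w, hw, hx⟩ := exists_grid_weights f A
  set y : (J : Finset (Fin d)) → (J → Fin P.size) → (Fin d → I) := fun J i =>
    faceExtend J fun j => P.pts (i j).castSucc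
  let m : ((J : Finset (Fin d)) → (J → Fin P.size) → ℝ) → Measure (Fin d → I) := fun v =>
    ∑ J : Finset (Fin d), ∑ i : J → Fin P.size, ENNReal.ofReal (v J i) • Measure.dirac (y J i)
  have hm : ∀ v S, MeasurableSet S → m v S =
      ∑ J : Finset (Fin d), ∑ i : J → Fin P.size, ENNReal.ofReal (v J i * S.indicator (fun _ => 1) (y J i)) := by
    intro v S hS
    simp only [m, Measure.finsetSum_apply, Measure.smul_apply, smul_eq_mul,
      Measure.dirac_apply' _ hS]
    refine Finset.sum_congr rfl fun J _ => Finset.sum_congr rfl fun i _ => ?_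
    by_cases h : y J i ∈ S <;> simp [h]
  have hfin : ∀ v, IsFiniteMeasure (m v) := fun v => ⟨by
    rw [hm _ _ MeasurableSet.univ]
    simp [ENNReal.sum_lt_top]⟩
  have hreal : ∀ v S, MeasurableSet S → (m v).real S =
      ∑ J : Finset (Fin d), ∑ i : J → Fin P.size, max (v J i) 0 * S.indicator (fun _ => 1) (y J i) := by
    intro v S hS
    rw [Measure.real, hm v S hS, ENNReal.toReal_sum (by simp [ENNReal.sum_eq_top])]
    refine Finset.sum_congr rfl fun J _ => ?_
    rw [ENNReal.toReal_sum (by simp)]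
    refine Finset.sum_congr rfl fun i _ => ?_
    rw [ENNReal.toReal_ofReal']
    by_cases h : y J i ∈ S <;> simp [h]
  refine ⟨⟨m w, hfin w⟩, ⟨m (-w), hfin (-w)⟩, ?_, ?_⟩
  · change m w univ + m (-w) univ ≤ _
    rw [hm _ _ MeasurableSet.univ, hm _ _ MeasurableSet.univ]
    simp_rw [← Finset.sum_add_distrib, Pi.neg_apply, indicator_univ, mul_one]
    rw [hardyKrause, Finset.sum_filter]
    refine Finset.sum_le_sum fun J _ => ?_
    have habs : ∀ i, ENNReal.ofReal (w J i) + ENNReal.ofReal (-w J i) = ENNReal.ofReal |w J i| := by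
      intro i
      rcases le_total 0 (w J i) with h | h
      · rw [abs_of_nonneg h, ENNReal.ofReal_of_nonpos (neg_nonpos.2 h), add_zero]
      · rw [abs_of_nonpos h, ENNReal.ofReal_of_nonpos h, zero_add]
    simp_rw [habs, hw]
    split_ifs with hJ
    · exact le_iSup (fun Q : J → Subdivision => ∑ i : ((j : J) → Fin (Q j).size),
        ENNReal.ofReal |boxDiff (restrictFace f J) (fun j => (Q j).pts (i j).castSucc)
          (fun j => (Q j).pts (i j).succ)|) (fun _ => P)
    · simp
  · intro x hxA
    change _ = (m w).real (Ici x) - (m (-w)).real (Ici x)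
    rw [hreal _ _ measurableSet_Ici, hreal _ _ measurableSet_Ici, hx x hxA]
    simp_rw [← Finset.sum_sub_distrib]
    refine Finset.sum_congr rfl fun J _ => Finset.sum_congr rfl fun i _ => ?_
    rw [← sub_mul, Pi.neg_apply, Pi.neg_apply]
    congr 1
    rcases le_total 0 (w J i) with h | h <;> simp [h]

/-! ### Monotone moduli, step approximation, measurability and boundedness -/

lemma exists_tendsto_ultrafilter_of_mem_Icc {α : Type*} (U : Ultrafilter α) (g : α → ℝ) {a b : ℝ}
    (h : ∀ x, g x ∈ Icc a b) : ∃ l, Tendsto g U (𝓝 l) := by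
  obtain ⟨l, -, hl⟩ := (isCompact_Icc (a := a) (b := b)).ultrafilter_le_nhds' (U.map g)
    (Filter.univ_mem' (f := (U : Filter α)) h)
  exact ⟨l, hl⟩

/-- A point of [x,1] outside [y,1] has some coordinate with x_j ≤ u_j < y_j; a union bound over
these slabs suffices. -/
lemma abs_sub_real_Ici_le {d : ℕ} (μ : Measure (Fin d → I)) [IsFiniteMeasure μ] (x y : Fin d → I) :
    |μ.real (Ici x) - μ.real (Ici y)| ≤
      ∑ j, |μ.real {u | u j < x j} - μ.real {u | u j < y j}| := by
  have hmeas : ∀ (j : Fin d) (s : I), MeasurableSet {u : Fin d → I | u j < s} := fun j s =>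
    measurableSet_lt (measurable_pi_apply j) measurable_const
  have key : ∀ x y : Fin d → I, μ.real (Ici x) - μ.real (Ici y) ≤
      ∑ j, |μ.real {u | u j < x j} - μ.real {u | u j < y j}| := by
    intro x y
    have h1 : μ.real (Ici x) ≤ μ.real (Ici y) + μ.real (⋃ j, {u | u j < y j} \ {u | u j < x j}) := by
      refine (measureReal_mono ?_).trans (measureReal_union_le _ _)
      intro u hu
      by_cases h : u ∈ Ici y
      · exact Or.inl h
      · right
        simp only [mem_Ici, Pi.le_def, not_forall, not_le] at h
        obtain ⟨j, hj⟩ := h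
        exact mem_iUnion.2 ⟨j, hj, not_lt.2 (hu j)⟩
    have h2 : μ.real (⋃ j, {u | u j < y j} \ {u | u j < x j}) ≤
        ∑ j, μ.real ({u | u j < y j} \ {u | u j < x j}) := measureReal_iUnion_fintype_le _
    refine (sub_le_iff_le_add'.2 h1).trans (h2.trans (Finset.sum_le_sum fun j _ => ?_))
    rcases le_total (x j) (y j) with h | h
    · have hsub : {u : Fin d → I | u j < x j} ⊆ {u | u j < y j} := fun u hu => lt_of_lt_of_le hu h
      rw [measureReal_sdiff hsub (hmeas _ _), abs_sub_comm]
      exact le_abs_self _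
    · have hsub : {u : Fin d → I | u j < y j} ⊆ {u | u j < x j} := fun u hu => lt_of_lt_of_le hu h
      rw [sdiff_eq_empty.2 hsub, measureReal_empty]
      exact abs_nonneg _
  refine abs_sub_le_iff.2 ⟨key x y, (key y x).trans_eq ?_⟩
  exact Finset.sum_congr rfl fun j _ => abs_sub_comm _ _

/-- A function of bounded variation in the sense of Hardy and Krause has its increments controlled
by monotone functions of the single coordinates. -/
lemma exists_monotone_modulus {d : ℕ} (f : (Fin d → I) → ℝ) (hf : hardyKrause f < ∞) :
    ∃ M : Fin d → I → ℝ, (∀ j, Monotone (M j)) ∧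
      ∀ x y, |f x - f y| ≤ ∑ j, |M j (x j) - M j (y j)| := by
  classical
  choose μ ν hV hμν using exists_grid_measures f
  -- Along an ultrafilter finer than `atTop`, all bounded quantities converge at once, and the grid
  -- eventually contains the coordinates of any given points.
  set U := Ultrafilter.of (atTop : Filter (Finset I))
  let N : Finset I → Fin d → I → ℝ := fun A j s =>
    (μ A : Measure (Fin d → I)).real {u | u j < s} + (ν A : Measure (Fin d → I)).real {u | u j < s}
  have hmono : ∀ A j, Monotone (N A j) := fun A j s t hst =>
    add_le_add (measureReal_mono fun u hu => lt_of_lt_of_le hu hst)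
      (measureReal_mono fun u hu => lt_of_lt_of_le hu hst)
  have hN : ∀ j s, ∃ l, Tendsto (fun A => N A j s) U (𝓝 l) := by
    intro j s
    refine exists_tendsto_ultrafilter_of_mem_Icc U _ (a := 0) (b := (hardyKrause f).toReal) fun A => ⟨by positivity, ?_⟩
    refine le_trans (add_le_add (measureReal_mono (subset_univ _)) (measureReal_mono (subset_univ _))) ?_
    rw [measureReal_def, measureReal_def, ← ENNReal.toReal_add (measure_ne_top _ _) (measure_ne_top _ _)]
    exact ENNReal.toReal_mono hf.ne (hV A)
  choose M hM using hN
  refine ⟨M, fun j s t hst => le_of_tendsto_of_tendsto' (hM j s) (hM j t) fun A => hmono A j hst,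
    fun x y => ?_⟩
  have hlim : Tendsto (fun A => ∑ j, |N A j (x j) - N A j (y j)|) U
      (𝓝 (∑ j, |M j (x j) - M j (y j)|)) :=
    tendsto_finsetSum _ fun j _ => ((hM j _).sub (hM j _)).abs
  refine ge_of_tendsto hlim ?_
  have hev : ∀ᶠ A in (U : Filter (Finset I)),
      Finset.univ.image x ∪ Finset.univ.image y ≤ A :=
    (Ultrafilter.of_le atTop) (eventually_ge_atTop _)
  filter_upwards [hev] with A hA
  have hx := hμν A x fun j => hA (by simp)
  have hy := hμν A y fun j => hA (by simp)
  have h1 := abs_sub_real_Ici_le (μ A : Measure (Fin d → I)) x y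
  have h2 := abs_sub_real_Ici_le (ν A : Measure (Fin d → I)) x y
  have h0 : f x - f y = ((μ A : Measure (Fin d → I)).real (Ici x) - (μ A : Measure _).real (Ici y)) -
      ((ν A : Measure (Fin d → I)).real (Ici x) - (ν A : Measure _).real (Ici y)) := by linarith
  have h3 := (abs_sub _ _).trans (add_le_add h1 h2)
  rw [← h0, ← Finset.sum_add_distrib] at h3
  refine h3.trans (Finset.sum_le_sum fun j _ => ?_)
  have m1 : Monotone fun s => (μ A : Measure (Fin d → I)).real {u | u j < s} := fun s t hst =>
    measureReal_mono fun u hu => lt_of_lt_of_le hu hst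
  have m2 : Monotone fun s => (ν A : Measure (Fin d → I)).real {u | u j < s} := fun s t hst =>
    measureReal_mono fun u hu => lt_of_lt_of_le hu hst
  simp only [N]
  -- Both increments have the same sign, so their absolute values add up exactly.
  rcases le_total (x j) (y j) with h | h
  · rw [abs_of_nonpos (sub_nonpos.2 (m1 h)), abs_of_nonpos (sub_nonpos.2 (m2 h)),
      abs_of_nonpos (by linarith [m1 h, m2 h])]
    linarith
  · rw [abs_of_nonneg (sub_nonneg.2 (m1 h)), abs_of_nonneg (sub_nonneg.2 (m2 h)),
      abs_of_nonneg (by linarith [m1 h, m2 h])]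
    linarith

/-- `q` sends each level set of ⌊M/δ⌋ to one chosen representative in it; bounded monotone `M` has
finitely many levels. -/
lemma exists_monotone_finite_range_near {M : I → ℝ} (hM : Monotone M) {δ : ℝ} (hδ : 0 < δ) :
    ∃ q : I → I, Monotone q ∧ (range q).Finite ∧ ∀ s, |M (q s) - M s| ≤ δ := by
  let K : I → ℤ := fun s => ⌊M s / δ⌋
  have hK : Monotone K := fun s t h => Int.floor_le_floor (by gcongr; exact hM h)
  have hinv : ∀ s, K (Function.invFun K (K s)) = K s := fun s => Function.invFun_eq ⟨s, rfl⟩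
  refine ⟨fun s => Function.invFun K (K s), fun s t h => ?_, ?_, fun s => ?_⟩
  · rcases (hK h).eq_or_lt with h' | h'
    · simp only [h', le_refl]
    · refine le_of_lt (not_le.1 fun hle => ?_)
      have := hK hle
      rw [hinv, hinv] at this
      exact absurd this (not_le.2 h')
  · have : (range K).Finite := (finite_Icc (K 0) (K 1)).subset (by
      rintro _ ⟨s, rfl⟩
      exact ⟨hK unitInterval.nonneg', hK unitInterval.le_one'⟩)
    refine (this.image (Function.invFun K)).subset ?_
    rintro _ ⟨s, rfl⟩
    exact mem_image_of_mem _ (mem_range_self s)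
  · have h := (Int.abs_sub_lt_one_of_floor_eq_floor (hinv s)).le
    rw [← sub_div, abs_div, abs_of_pos hδ, div_le_one hδ] at h
    exact h

lemma exists_step_approx {d : ℕ} (f : (Fin d → I) → ℝ) (hf : hardyKrause f < ∞) {ε : ℝ}
    (hε : 0 < ε) :
    ∃ q : Fin d → I → I, (∀ j, Monotone (q j)) ∧ (∀ j, (range (q j)).Finite) ∧
      ∀ x, |f (fun j => q j (x j)) - f x| ≤ ε := by
  obtain ⟨M, hM, hfM⟩ := exists_monotone_modulus f hf
  -- The denominator `d + 1` instead of `d` covers dimension 0.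
  have hδ : 0 < ε / (d + 1) := by positivity
  choose q hq hfin hqM using fun j => exists_monotone_finite_range_near (hM j) hδ
  refine ⟨q, hq, hfin, fun x => (hfM _ _).trans ((Finset.sum_le_sum fun j _ => hqM j (x j)).trans ?_)⟩
  simp only [Finset.sum_const, Finset.card_univ, Fintype.card_fin, nsmul_eq_mul]
  rw [← mul_div_assoc, div_le_iff₀ (by positivity)]
  nlinarith

lemma measurable_comp_of_finite_range {d : ℕ} (f : (Fin d → I) → ℝ) {q : Fin d → I → I}
    (hq : ∀ j, Monotone (q j)) (hfin : ∀ j, (range (q j)).Finite) :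
    Measurable fun x : Fin d → I => f fun j => q j (x j) := by
  let Q : (Fin d → I) → (Fin d → I) := fun x j => q j (x j)
  have hQ : Measurable Q := measurable_pi_lambda _ fun j =>
    (hq j).measurable.comp (measurable_pi_apply j)
  have hr : (range Q).Finite := (Finite.pi' hfin).subset (by
    rintro _ ⟨x, rfl⟩ j
    exact mem_range_self _)
  have : Finite (range Q) := hr
  exact (measurable_of_countable fun y : range Q => f y).comp
    (hQ.subtype_mk (h := fun x => mem_range_self x))

lemma measurable_of_hardyKrause_lt_top {d : ℕ} (f : (Fin d → I) → ℝ) (hf : hardyKrause f < ∞) :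
    Measurable f := by
  have hpos : ∀ n : ℕ, (0 : ℝ) < 1 / ((n : ℝ) + 1) := fun n => Nat.one_div_pos_of_nat
  choose q hq hfin hqf using fun n => exists_step_approx f hf (hpos n)
  refine measurable_of_tendsto_metrizable (fun n => measurable_comp_of_finite_range f (hq n) (hfin n))
    (tendsto_pi_nhds.2 fun x => ?_)
  rw [tendsto_iff_dist_tendsto_zero]
  exact squeeze_zero (fun _ => dist_nonneg) (fun n => hqf n x) tendsto_one_div_add_atTop_nhds_zero_nat

lemma exists_abs_le_of_hardyKrause_lt_top {d : ℕ} (f : (Fin d → I) → ℝ) (hf : hardyKrause f < ∞) :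
    ∃ C, ∀ x, |f x| ≤ C := by
  obtain ⟨M, hM, hfM⟩ := exists_monotone_modulus f hf
  refine ⟨|f 1| + ∑ j, (M j 1 - M j 0), fun x => ?_⟩
  have h1 : |f x| ≤ |f 1| + |f x - f 1| := by
    have := abs_add_le (f 1) (f x - f 1)
    simpa using this
  refine h1.trans (add_le_add_right ((hfM x 1).trans (Finset.sum_le_sum fun j _ => ?_)) _)
  rw [abs_sub_comm, Pi.one_apply, abs_of_nonneg (sub_nonneg.2 (hM j unitInterval.le_one'))]
  linarith [hM j (unitInterval.nonneg' (t := x j))]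

/-! ### The Koksma–Hlawka inequality -/

lemma exists_monotone_seq_iUnion_Iic {B : Set I} (hB : IsLowerSet B) (hne : B.Nonempty) :
    ∃ u : ℕ → I, Monotone u ∧ ⋃ n, Iic (u n) = B := by
  by_cases hc : sSup B ∈ B
  · refine ⟨fun _ => sSup B, monotone_const, ?_⟩
    rw [iUnion_const]
    exact Subset.antisymm (fun x hx => hB hx hc) fun x hx => le_sSup hx
  · obtain ⟨u, hu, hlim, hmem⟩ := exists_seq_tendsto_sSup hne (OrderTop.bddAbove B)
    refine ⟨u, hu, Subset.antisymm (iUnion_subset fun n x hx => hB hx (hmem n)) fun x hx => ?_⟩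
    have hlt : x < sSup B := lt_of_le_of_ne (le_sSup hx) fun h => hc (h ▸ hx)
    obtain ⟨n, hn⟩ := (hlim.eventually (eventually_gt_nhds hlt)).exists
    exact mem_iUnion.2 ⟨n, hn.le⟩

/-- Such a product is an increasing union of closed boxes [0,u], or empty, so the bound passes to
the limit by continuity from below. -/
lemma abs_sub_real_lower_le {d : ℕ} (ρ κ : Measure (Fin d → I)) [IsFiniteMeasure ρ]
    [IsFiniteMeasure κ] {D : ℝ} (hD : ∀ t, |κ.real (Iic t) - ρ.real (Iic t)| ≤ D)
    {B : Fin d → Set I} (hB : ∀ j, IsLowerSet (B j)) :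
    |κ.real {x | ∀ j, x j ∈ B j} - ρ.real {x | ∀ j, x j ∈ B j}| ≤ D := by
  by_cases hne : ∀ j, (B j).Nonempty
  · choose u hu hU using fun j => exists_monotone_seq_iUnion_Iic (hB j) (hne j)
    have hmono : Monotone fun n => Iic (fun j => u j n : Fin d → I) := fun m n h =>
      Iic_subset_Iic.2 fun j => hu j h
    have heq : ⋃ n, Iic (fun j => u j n : Fin d → I) = {x | ∀ j, x j ∈ B j} := by
      ext x
      simp only [mem_iUnion, mem_ofPred_eq, ← hU, mem_Iic]
      constructor
      · rintro ⟨n, hn⟩ j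
        exact ⟨n, hn j⟩
      · intro h
        choose k hk using h
        refine ⟨Finset.univ.sup k, fun j => (hk j).trans (hu j (Finset.le_sup (Finset.mem_univ j)))⟩
    have ht : ∀ (μ : Measure (Fin d → I)) [IsFiniteMeasure μ],
        Tendsto (fun n => μ.real (Iic (fun j => u j n : Fin d → I))) atTop
          (𝓝 (μ.real {x | ∀ j, x j ∈ B j})) := by
      intro μ _
      rw [← heq]
      exact (ENNReal.tendsto_toReal (measure_ne_top _ _)).comp (tendsto_measure_iUnion_atTop hmono)
    exact le_of_tendsto' ((ht κ).sub (ht ρ)).abs fun n => hD _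
  · push Not at hne
    obtain ⟨j, hj⟩ := hne
    have : {x : Fin d → I | ∀ j, x j ∈ B j} = ∅ := by
      refine eq_empty_of_forall_notMem fun x hx => ?_
      have := hx j
      simp [hj] at this
    rw [this]
    simpa using (abs_nonneg _).trans (hD 0)

/-- Both integrals are the product measure of {(x,t) : q x ≤ t}. -/
lemma integral_real_Ici_comp {d : ℕ} (ρ μ : Measure (Fin d → I)) [IsFiniteMeasure ρ]
    [IsFiniteMeasure μ] {q : (Fin d → I) → (Fin d → I)} (hq : Measurable q) :
    ∫ x, μ.real (Ici (q x)) ∂ρ = ∫ t, ρ.real {x | q x ≤ t} ∂μ ∧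
      Integrable (fun x => μ.real (Ici (q x))) ρ ∧ Integrable (fun t => ρ.real {x | q x ≤ t}) μ := by
  have hS : MeasurableSet {p : (Fin d → I) × (Fin d → I) | q p.1 ≤ p.2} :=
    measurableSet_le (hq.comp measurable_fst) measurable_snd
  have m1 : Measurable fun x => μ (Ici (q x)) := measurable_measure_prodMk_left hS
  have m2 : Measurable fun t => ρ {x | q x ≤ t} := measurable_measure_prodMk_right hS
  refine ⟨?_, ?_, ?_⟩
  · simp only [measureReal_def]
    rw [integral_toReal m1.aemeasurable (.of_forall fun _ => measure_lt_top _ _),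
      integral_toReal m2.aemeasurable (.of_forall fun _ => measure_lt_top _ _)]
    congr 1
    exact (Measure.prod_apply hS).symm.trans (Measure.prod_apply_symm hS)
  · refine Integrable.of_bound m1.ennreal_toReal.aestronglyMeasurable (μ.real univ)
      (.of_forall fun x => ?_)
    rw [Real.norm_of_nonneg measureReal_nonneg]
    exact measureReal_mono (subset_univ _)
  · refine Integrable.of_bound m2.ennreal_toReal.aestronglyMeasurable (ρ.real univ)
      (.of_forall fun x => ?_)
    rw [Real.norm_of_nonneg measureReal_nonneg]
    exact measureReal_mono (subset_univ _)

lemma integrable_of_hardyKrause_lt_top {d : ℕ} (f : (Fin d → I) → ℝ) (hf : hardyKrause f < ∞)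
    (ρ : Measure (Fin d → I)) [IsFiniteMeasure ρ] : Integrable f ρ := by
  obtain ⟨C, hC⟩ := exists_abs_le_of_hardyKrause_lt_top f hf
  exact Integrable.of_bound (measurable_of_hardyKrause_lt_top f hf).aestronglyMeasurable C
    (.of_forall hC)

lemma abs_integral_sub_step_le {d : ℕ} (f : (Fin d → I) → ℝ) (hf : hardyKrause f < ∞)
    (ρ κ : Measure (Fin d → I)) [IsProbabilityMeasure ρ] [IsProbabilityMeasure κ] {D : ℝ}
    (hD : ∀ t, |κ.real (Iic t) - ρ.real (Iic t)| ≤ D) {q : Fin d → I → I}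
    (hq : ∀ j, Monotone (q j)) (hfin : ∀ j, (range (q j)).Finite) :
    |∫ x, f (fun j => q j (x j)) ∂ρ - ∫ x, f (fun j => q j (x j)) ∂κ| ≤
      (hardyKrause f).toReal * D := by
  classical
  obtain ⟨μ, ν, hV, hμν⟩ := exists_grid_measures f (Finset.univ.biUnion fun j => (hfin j).toFinset)
  set Q : (Fin d → I) → (Fin d → I) := fun x j => q j (x j)
  have hQ : Measurable Q := measurable_pi_lambda _ fun j =>
    (hq j).measurable.comp (measurable_pi_apply j)
  have hfQ : ∀ x, f (Q x) =
      (μ : Measure (Fin d → I)).real (Ici (Q x)) - (ν : Measure _).real (Ici (Q x)) + f 1 := by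
    intro x
    rw [← hμν (Q x) fun j => Finset.mem_biUnion.2
      ⟨j, Finset.mem_univ j, (hfin j).mem_toFinset.2 (mem_range_self (x j))⟩]
    ring
  have hint : ∀ (τ : Measure (Fin d → I)) [IsProbabilityMeasure τ], ∫ x, f (Q x) ∂τ =
      ∫ t, τ.real {x | Q x ≤ t} ∂(μ : Measure (Fin d → I)) -
        ∫ t, τ.real {x | Q x ≤ t} ∂(ν : Measure (Fin d → I)) + f 1 := by
    intro τ _
    obtain ⟨e1, i1, -⟩ := integral_real_Ici_comp τ (μ : Measure (Fin d → I)) hQ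
    obtain ⟨e2, i2, -⟩ := integral_real_Ici_comp τ (ν : Measure (Fin d → I)) hQ
    have i3 : Integrable (fun x => (μ : Measure (Fin d → I)).real (Ici (Q x)) -
      (ν : Measure (Fin d → I)).real (Ici (Q x))) τ := i1.sub i2
    simp_rw [hfQ]
    rw [integral_add i3 (integrable_const _), integral_sub i1 i2, e1, e2]
    simp
  have hbound : ∀ (η : Measure (Fin d → I)) [IsFiniteMeasure η],
      |∫ t, ρ.real {x | Q x ≤ t} ∂η - ∫ t, κ.real {x | Q x ≤ t} ∂η| ≤ D * η.real univ := by
    intro η _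
    rw [← integral_sub (integral_real_Ici_comp ρ η hQ).2.2 (integral_real_Ici_comp κ η hQ).2.2]
    rw [← Real.norm_eq_abs]
    refine norm_integral_le_of_norm_le_const (.of_forall fun t => ?_)
    rw [Real.norm_eq_abs, abs_sub_comm]
    -- Monotonicity of `q j` makes {s : q j s ≤ t j} a lower set, possibly not closed.
    exact abs_sub_real_lower_le ρ κ hD (B := fun j => {s | q j s ≤ t j})
      fun j a b hab ha => (hq j hab).trans ha
  have hD0 : 0 ≤ D := (abs_nonneg _).trans (hD 0)
  have hV' : (μ : Measure (Fin d → I)).real univ + (ν : Measure (Fin d → I)).real univ ≤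
      (hardyKrause f).toReal := by
    rw [measureReal_def, measureReal_def, ← ENNReal.toReal_add (measure_ne_top _ _) (measure_ne_top _ _)]
    exact ENNReal.toReal_mono hf.ne hV
  rw [hint ρ, hint κ]
  have h1 := hbound (μ : Measure (Fin d → I))
  have h2 := hbound (ν : Measure (Fin d → I))
  rw [abs_le] at h1 h2 ⊢
  have h3 := mul_le_mul_of_nonneg_left hV' hD0
  constructor <;> linarith

/-- The Koksma–Hlawka inequality for two probability measures on `[0,1]^d`. -/
theorem abs_integral_sub_integral_le {d : ℕ} (f : (Fin d → I) → ℝ) (hf : hardyKrause f < ∞)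
    (ρ κ : Measure (Fin d → I)) [IsProbabilityMeasure ρ] [IsProbabilityMeasure κ] {D : ℝ}
    (hD : ∀ t, |κ.real (Iic t) - ρ.real (Iic t)| ≤ D) :
    |∫ x, f x ∂ρ - ∫ x, f x ∂κ| ≤ (hardyKrause f).toReal * D := by
  refine le_of_forall_pos_le_add fun ε hε => ?_
  obtain ⟨q, hq, hfin, hqf⟩ := exists_step_approx f hf (half_pos hε)
  have hdiff : ∀ (τ : Measure (Fin d → I)) [IsProbabilityMeasure τ],
      |∫ x, f x ∂τ - ∫ x, f (fun j => q j (x j)) ∂τ| ≤ ε / 2 := by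
    intro τ _
    have hi := integrable_of_hardyKrause_lt_top f hf τ
    obtain ⟨C, hC⟩ := exists_abs_le_of_hardyKrause_lt_top f hf
    have hi' : Integrable (fun x : Fin d → I => f fun j => q j (x j)) τ :=
      Integrable.of_bound (measurable_comp_of_finite_range f hq hfin).aestronglyMeasurable C
        (.of_forall fun x => hC _)
    rw [← integral_sub hi hi']
    rw [← Real.norm_eq_abs]
    refine (norm_integral_le_of_norm_le_const (C := ε / 2) (.of_forall fun x => ?_)).trans (by simp)
    rw [Real.norm_eq_abs, abs_sub_comm]
    exact hqf x
  have h1 := hdiff ρ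
  have h2 := hdiff κ
  have h3 := abs_integral_sub_step_le f hf ρ κ hD hq hfin
  rw [abs_le] at h1 h2 h3 ⊢
  constructor <;> linarith

/-! ### The empirical measure -/

/-- The empirical measure of a dataset. -/
noncomputable def empiricalMeasure {d m : ℕ} (p : Fin m → Fin d → I) : Measure (Fin d → I) :=
  ENNReal.ofReal (1 / (m : ℝ)) • ∑ i, Measure.dirac (p i)

lemma empiricalMeasure_real {d m : ℕ} (p : Fin m → Fin d → I) {B : Set (Fin d → I)}
    (hB : MeasurableSet B) : (empiricalMeasure p).real B = empiricalFraction p B := by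
  rw [empiricalMeasure, measureReal_ennreal_smul_apply, ENNReal.toReal_ofReal (by positivity),
    empiricalFraction, measureReal_def, Measure.finsetSum_apply]
  simp_rw [Measure.dirac_apply' _ hB]
  congr 1
  rw [ENNReal.toReal_sum]
  · refine Finset.sum_congr rfl fun i _ => ?_
    by_cases h : p i ∈ B <;> simp [h]
  · intro i _
    by_cases h : p i ∈ B <;> simp [h]

lemma isProbabilityMeasure_empiricalMeasure {d m : ℕ} (hm : 0 < m) (p : Fin m → Fin d → I) :
    IsProbabilityMeasure (empiricalMeasure p) := by
  constructor
  have hm' : (0 : ℝ) < m := Nat.cast_pos.2 hm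
  rw [empiricalMeasure, Measure.smul_apply, Measure.finsetSum_apply]
  simp only [measure_univ, Finset.sum_const, Finset.card_univ, Fintype.card_fin, nsmul_eq_mul,
    mul_one, smul_eq_mul]
  rw [← ENNReal.ofReal_natCast, ← ENNReal.ofReal_mul (by positivity), one_div,
    inv_mul_cancel₀ hm'.ne', ENNReal.ofReal_one]

lemma integral_empiricalMeasure {d m : ℕ} (p : Fin m → Fin d → I) {g : (Fin d → I) → ℝ}
    (hg : Measurable g) : ∫ x, g x ∂(empiricalMeasure p) = (1 / (m : ℝ)) * ∑ i, g (p i) := by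
  rw [empiricalMeasure, integral_smul_measure, ENNReal.toReal_ofReal (by positivity),
    integral_finsetSum_measure fun i _ => integrable_dirac' hg.stronglyMeasurable (by simp), smul_eq_mul]
  simp_rw [integral_dirac' _ _ hg.stronglyMeasurable]

/-! ### Weak limits of the grid measures and left-continuity -/

/-- The case `s j = 0` is allowed because that coordinate then imposes no condition in `Ici s`. -/
lemma Ici_subset_interior_Ici {d : ℕ} {s t : Fin d → I} (h : ∀ j, s j < t j ∨ s j = 0) :
    Ici t ⊆ interior (Ici s) := by
  have ho : IsOpen {u : Fin d → I | ∀ j, s j < u j ∨ s j = 0} := by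
    simp only [ofPred_forall]
    refine isOpen_iInter_of_finite fun j => ?_
    by_cases h0 : s j = 0
    · simp [h0]
    · simp only [h0, or_false]
      exact isOpen_lt continuous_const (continuous_apply j)
  have hsub : {u : Fin d → I | ∀ j, s j < u j ∨ s j = 0} ⊆ Ici s := by
    intro u hu j
    rcases hu j with h' | h'
    · exact h'.le
    · rw [h']; exact unitInterval.nonneg'
  exact fun u hu => interior_maximal hsub ho fun j => (h j).imp_left fun h' => h'.trans_le (hu j)

/-- A Urysohn function between the indicators of `Ici t` and `Ici s` has convergent integrals,
although the measures of the boxes themselves need not converge to those of the limit. -/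
lemma real_Ici_bounds_of_tendsto {d : ℕ} {α : Type*} {F : Filter α} [F.NeBot]
    {m : α → FiniteMeasure (Fin d → I)} {m₀ : FiniteMeasure (Fin d → I)}
    (hm : Tendsto m F (𝓝 m₀)) {s t : Fin d → I} (hst : Ici t ⊆ interior (Ici s)) {a b : ℝ}
    (ha : Tendsto (fun x => (m x : Measure (Fin d → I)).real (Ici t)) F (𝓝 a))
    (hb : Tendsto (fun x => (m x : Measure (Fin d → I)).real (Ici s)) F (𝓝 b)) :
    a ≤ (m₀ : Measure (Fin d → I)).real (Ici s) ∧
      (m₀ : Measure (Fin d → I)).real (Ici t) ≤ b := by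
  obtain ⟨φ, h0, h1, h01⟩ := exists_continuous_zero_one_of_isClosed
    (isOpen_interior (s := Ici s)).isClosed_compl (isClosed_Ici (a := t))
    (disjoint_compl_left_iff_subset.2 hst)
  let ψ : BoundedContinuousFunction (Fin d → I) ℝ := BoundedContinuousFunction.mkOfCompact φ
  have hlim : Tendsto (fun x => ∫ u, φ u ∂(m x : Measure (Fin d → I))) F
      (𝓝 (∫ u, φ u ∂(m₀ : Measure (Fin d → I)))) :=
    (FiniteMeasure.tendsto_iff_forall_integral_tendsto.1 hm) ψ
  have hint : ∀ η : FiniteMeasure (Fin d → I), Integrable φ (η : Measure (Fin d → I)) := fun η =>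
    ψ.integrable _
  have hlow : ∀ η : FiniteMeasure (Fin d → I),
      (η : Measure (Fin d → I)).real (Ici t) ≤ ∫ u, φ u ∂(η : Measure (Fin d → I)) := by
    intro η
    rw [← integral_indicator_one measurableSet_Ici]
    refine integral_mono ((integrable_const 1).indicator measurableSet_Ici) (hint η) fun u => ?_
    by_cases hu : u ∈ Ici t
    · rw [indicator_of_mem hu, h1 hu]
    · rw [indicator_of_notMem hu]; exact (h01 u).1
  have hup : ∀ η : FiniteMeasure (Fin d → I),
      ∫ u, φ u ∂(η : Measure (Fin d → I)) ≤ (η : Measure (Fin d → I)).real (Ici s) := by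
    intro η
    rw [← integral_indicator_one measurableSet_Ici]
    refine integral_mono (hint η) ((integrable_const 1).indicator measurableSet_Ici) fun u => ?_
    by_cases hu : u ∈ Ici s
    · rw [indicator_of_mem hu]; exact (h01 u).2
    · rw [indicator_of_notMem hu, h0 fun h => hu (interior_subset h)]; rfl
  exact ⟨(le_of_tendsto_of_tendsto' ha hlim fun x => hlow _).trans (hup m₀),
    (hlow m₀).trans (le_of_tendsto_of_tendsto' hlim hb fun x => hup _)⟩

/-- Limits of the discrete measures on finer and finer grids determine `f` up to left limits. -/
lemma exists_limit_measures {d : ℕ} (f : (Fin d → I) → ℝ) (hf : hardyKrause f < ∞) :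
    ∃ μ ν : FiniteMeasure (Fin d → I),
      (μ : Measure (Fin d → I)) univ + (ν : Measure (Fin d → I)) univ ≤ hardyKrause f ∧
      ∀ r s t : Fin d → I, Ici s ⊆ interior (Ici r) → Ici t ⊆ interior (Ici s) →
        |f s - f 1 - ((μ : Measure (Fin d → I)).real (Ici t) - (ν : Measure _).real (Ici t))| ≤
          ((μ : Measure (Fin d → I)).real (Ici r) - (μ : Measure _).real (Ici t)) +
          ((ν : Measure (Fin d → I)).real (Ici r) - (ν : Measure _).real (Ici t)) := by
  classical
  choose μ ν hV hμν using exists_grid_measures f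
  have hVn : ∀ A, (μ A).mass + (ν A).mass ≤ (hardyKrause f).toNNReal := by
    intro A
    rw [← ENNReal.coe_le_coe, ENNReal.coe_toNNReal hf.ne, ENNReal.coe_add,
      FiniteMeasure.ennreal_mass, FiniteMeasure.ennreal_mass]
    exact hV A
  set U := Ultrafilter.of (atTop : Filter (Finset I))
  have hK := isCompact_setOfPred_finiteMeasure_le_of_compactSpace (Fin d → I)
    (hardyKrause f).toNNReal
  obtain ⟨μ₀, -, hμ₀⟩ := hK.ultrafilter_le_nhds' (U.map μ)
    (Filter.univ_mem' (f := (U : Filter _)) fun A => le_self_add.trans (hVn A))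
  obtain ⟨ν₀, -, hν₀⟩ := hK.ultrafilter_le_nhds' (U.map ν)
    (Filter.univ_mem' (f := (U : Filter _)) fun A => le_add_self.trans (hVn A))
  have hμ : Tendsto μ U (𝓝 μ₀) := hμ₀
  have hν : Tendsto ν U (𝓝 ν₀) := hν₀
  have hlim : ∀ (m : Finset I → FiniteMeasure (Fin d → I)),
      (∀ A, (m A).mass ≤ (hardyKrause f).toNNReal) → ∀ t, ∃ l,
        Tendsto (fun A => (m A : Measure (Fin d → I)).real (Ici t)) U (𝓝 l) := by
    intro m hm t
    refine exists_tendsto_ultrafilter_of_mem_Icc U _ (a := 0) (b := (hardyKrause f).toNNReal)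
      fun A => ⟨measureReal_nonneg, (measureReal_mono (subset_univ _)).trans ?_⟩
    exact NNReal.coe_le_coe.2 (hm A)
  choose G hG using hlim μ fun A => le_self_add.trans (hVn A)
  choose H hH using hlim ν fun A => le_add_self.trans (hVn A)
  have hfGH : ∀ t, f t - f 1 = G t - H t := by
    intro t
    refine tendsto_nhds_unique ?_ ((hG t).sub (hH t))
    refine tendsto_const_nhds.congr' ?_
    have hev : ∀ᶠ A in (U : Filter (Finset I)), Finset.univ.image t ≤ A :=
      (Ultrafilter.of_le atTop) (eventually_ge_atTop _)
    filter_upwards [hev] with A hA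
    exact hμν A t fun j => hA (by simp)
  refine ⟨μ₀, ν₀, ?_, fun r s t hrs hst => ?_⟩
  · have h := le_of_tendsto' (((FiniteMeasure.continuous_mass.tendsto _).comp hμ).add
      ((FiniteMeasure.continuous_mass.tendsto _).comp hν)) hVn
    rw [← ENNReal.coe_le_coe, ENNReal.coe_toNNReal hf.ne, ENNReal.coe_add,
      FiniteMeasure.ennreal_mass, FiniteMeasure.ennreal_mass] at h
    exact h
  -- `G s` lies between the μ₀-measures of `Ici t` and `Ici r`, and `H s` between the ν₀-measures;
  -- `f s - f 1` is their difference.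
  · have h1 := (real_Ici_bounds_of_tendsto hμ hst (hG t) (hG s)).2
    have h2 := (real_Ici_bounds_of_tendsto hν hst (hH t) (hH s)).2
    have h3 := (real_Ici_bounds_of_tendsto hμ hrs (hG s) (hG r)).1
    have h4 := (real_Ici_bounds_of_tendsto hν hrs (hH s) (hH r)).1
    rw [hfGH, abs_le]
    constructor <;> linarith

lemma exists_monotone_seq_tendsto_Ici {d : ℕ} (t : Fin d → I) :
    ∃ r : ℕ → Fin d → I, (∀ n j, r n j < t j ∨ r n j = 0) ∧
      ∀ (η : Measure (Fin d → I)) [IsFiniteMeasure η],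
        Tendsto (fun n => η.real (Ici (r n))) atTop (𝓝 (η.real (Ici t))) := by
  -- Scaling by c_n = 1 − 1/(n+1) lowers every nonzero coordinate and fixes 0, hence the two
  -- alternatives.
  let c : ℕ → I := fun n => unitInterval.symm
    ⟨1 / ((n : ℝ) + 1), by positivity, by rw [div_le_one (by positivity)]; linarith [n.cast_nonneg (α := ℝ)]⟩
  have hc : ∀ n, ((c n : I) : ℝ) = 1 - 1 / ((n : ℝ) + 1) := fun n => rfl
  have hr : ∀ n j, ((c n * t j : I) : ℝ) = (1 - 1 / ((n : ℝ) + 1)) * t j := fun n j => by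
    rw [← hc]; rfl
  refine ⟨fun n j => c n * t j, fun n j => ?_, fun η _ => ?_⟩
  · rcases eq_or_lt_of_le (unitInterval.nonneg' (t := t j)) with h | h
    · right; beta_reduce; rw [← h, mul_zero]
    · left
      rw [← Subtype.coe_lt_coe, hr]
      have h' : (0 : ℝ) < t j := h
      have : (0 : ℝ) < 1 / ((n : ℝ) + 1) := by positivity
      nlinarith
  · have hanti : Antitone fun n => Ici (fun j => c n * t j : Fin d → I) := by
      intro m n hmn
      refine Ici_subset_Ici.2 fun j => ?_
      rw [← Subtype.coe_le_coe, hr, hr]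
      refine mul_le_mul_of_nonneg_right ?_ (t j).2.1
      have := Nat.one_div_le_one_div (α := ℝ) hmn
      linarith
    have heq : ⋂ n, Ici (fun j => c n * t j : Fin d → I) = Ici t := by
      refine Subset.antisymm (fun u hu j => ?_) (subset_iInter fun n => Ici_subset_Ici.2 fun j => ?_)
      · rw [← Subtype.coe_le_coe]
        have hlim : Tendsto (fun n : ℕ => (1 - 1 / ((n : ℝ) + 1)) * (t j : ℝ)) atTop
            (𝓝 ((1 - 0) * (t j : ℝ))) :=
          (tendsto_const_nhds.sub tendsto_one_div_add_atTop_nhds_zero_nat).mul_const _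
        rw [sub_zero, one_mul] at hlim
        refine le_of_tendsto' hlim fun n => ?_
        rw [← hr]
        exact (mem_iInter.1 hu n) j
      · exact unitInterval.mul_le_right
    rw [← heq]
    exact (ENNReal.tendsto_toReal (measure_ne_top _ _)).comp
      (tendsto_measure_iInter_atTop (fun n => measurableSet_Ici.nullMeasurableSet) hanti
        ⟨0, measure_ne_top _ _⟩)

/-- Separate left-continuity suffices because coordinates are moved up to `t` one at a time, by
induction on the set of coordinates allowed to have reached it. -/
lemma abs_sub_le_of_leftContinuous {d : ℕ} {f : (Fin d → I) → ℝ}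
    (hlc : LeftContinuousComponentwise f) {r t : Fin d → I} (hrt : ∀ j, r j < t j ∨ r j = 0)
    {c ε : ℝ} (h : ∀ s : Fin d → I, (∀ j, r j < s j ∨ r j = 0) → (∀ j, s j < t j ∨ s j = 0) →
      |f s - c| ≤ ε) : |f t - c| ≤ ε := by
  classical
  have key : ∀ S : Finset (Fin d), ∀ s : Fin d → I, s ≤ t → (∀ j, r j < s j ∨ r j = 0) →
      (∀ j ∉ S, s j < t j ∨ s j = 0) → |f s - c| ≤ ε := by
    intro S
    induction S using Finset.induction_on with
    | empty => exact fun s _ hrs hst => h s hrs fun j => hst j (by simp)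
    | insert a S ha ih =>
      intro s hle hrs hst
      by_cases hsa : s a < t a ∨ s a = 0
      · refine ih s hle hrs fun j hj => ?_
        by_cases hja : j = a
        · rw [hja]; exact hsa
        · exact hst j (by simp [hj, hja])
      -- Here `s a = t a ≠ 0`: the bound holds with this coordinate replaced by any x in (r a, s a),
      -- and x increases to `s a`.
      · push Not at hsa
        have hras : r a < s a := by
          rcases hrs a with h' | h'
          · exact h'
          · rw [h']; exact lt_of_le_of_ne unitInterval.nonneg' (Ne.symm hsa.2)
        have hne : (𝓝[<] (s a)).NeBot := nhdsLT_neBot_of_exists_lt ⟨_, hras⟩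
        have hlim : Tendsto (fun x : I => |f (Function.update s a x) - c|) (𝓝[<] (s a))
            (𝓝 (|f (Function.update s a (s a)) - c|)) :=
          ((((hlc s a).mono Iio_subset_Iic_self).tendsto).sub_const c).abs
        rw [Function.update_eq_self] at hlim
        refine le_of_tendsto hlim ?_
        filter_upwards [Ioo_mem_nhdsLT hras] with x hx
        refine ih _ (fun j => ?_) (fun j => ?_) fun j hj => ?_
        · by_cases hja : j = a
          · subst hja; simpa using hx.2.le.trans (hle j)
          · simpa [hja] using hle j
        · by_cases hja : j = a
          · subst hja; left; simpa using hx.1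
          · simpa [hja] using hrs j
        · by_cases hja : j = a
          · subst hja; left; simpa using hx.2.trans_le (hle j)
          · simpa [hja] using hst j (by simp [hj, hja])
  exact key Finset.univ t le_rfl hrt (by simp)

/-- A left-continuous function of bounded variation in the sense of Hardy and Krause is the
distribution function of the difference of two measures of total mass at most its variation. -/
lemma exists_measures_of_leftContinuous {d : ℕ} (f : (Fin d → I) → ℝ) (hf : hardyKrause f < ∞)
    (hlc : LeftContinuousComponentwise f) :
    ∃ μ ν : FiniteMeasure (Fin d → I),
      (μ : Measure (Fin d → I)) univ + (ν : Measure (Fin d → I)) univ ≤ hardyKrause f ∧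
      ∀ t, f t - f 1 = (μ : Measure (Fin d → I)).real (Ici t) - (ν : Measure _).real (Ici t) := by
  obtain ⟨μ, ν, hV, h⟩ := exists_limit_measures f hf
  refine ⟨μ, ν, hV, fun t => ?_⟩
  obtain ⟨r, hrt, hlim⟩ := exists_monotone_seq_tendsto_Ici t
  have hz := ((hlim (μ : Measure (Fin d → I))).sub_const ((μ : Measure (Fin d → I)).real (Ici t))).add
    ((hlim (ν : Measure (Fin d → I))).sub_const ((ν : Measure (Fin d → I)).real (Ici t)))
  simp only [sub_self, add_zero] at hz
  have hb : |f t - (f 1 + ((μ : Measure (Fin d → I)).real (Ici t) - (ν : Measure _).real (Ici t)))| ≤ 0 := by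
    -- The error at `r n` is the measure gained from `Ici t` to `Ici (r n)`, which tends to 0.
    refine ge_of_tendsto' hz fun n => ?_
    refine abs_sub_le_of_leftContinuous hlc (hrt n) fun s hrs hst => ?_
    rw [← sub_sub]
    exact h (r n) s t (Ici_subset_interior_Ici hrs) (Ici_subset_interior_Ici hst)
  have := abs_eq_zero.1 (le_antisymm hb (abs_nonneg _))
  linarith

/-! ### Total variation and integration of the representing signed measure -/

lemma measurableSet_faceBox {d : ℕ} (J : Finset (Fin d)) (a b : J → I) :
    MeasurableSet (faceBox J a b) := by
  have : faceBox J a b = (⋂ j : J, {u : Fin d → I | a j ≤ u j ∧ u j < b j}) ∩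
      ⋂ j, ⋂ _ : j ∉ J, {u : Fin d → I | u j = 1} := by
    ext u; simp [faceBox]
  rw [this]
  refine (MeasurableSet.iInter fun j => ?_).inter
    (.iInter fun j => .iInter fun _ => measurableSet_eq_fun (measurable_pi_apply j) measurable_const)
  have h1 : MeasurableSet {u : Fin d → I | a j ≤ u j} :=
    measurableSet_le measurable_const (measurable_pi_apply _)
  have h2 : MeasurableSet {u : Fin d → I | u j < b j} :=
    measurableSet_lt (measurable_pi_apply _) measurable_const
  exact h1.inter h2

lemma measureReal_faceBox {d : ℕ} (μ : Measure (Fin d → I)) [IsFiniteMeasure μ]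
    (J : Finset (Fin d)) (a b : J → I) (hab : a ≤ b) :
    μ.real (faceBox J a b) = ∑ s : Finset J, (-1 : ℝ) ^ s.card *
      μ.real (Ici (faceExtend J fun j => if j ∈ s then b j else a j)) := by
  have hi : ∀ t : Fin d → I, Integrable ((Ici t).indicator fun _ => (1 : ℝ)) μ := fun t =>
    (integrable_const 1).indicator measurableSet_Ici
  have hint : ∀ B : Set (Fin d → I), MeasurableSet B →
      ∫ u, B.indicator (fun _ => (1 : ℝ)) u ∂μ = μ.real B := fun B hB => by
    rw [integral_indicator_const _ hB, smul_eq_mul, mul_one]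
  rw [← hint _ (measurableSet_faceBox J a b)]
  simp_rw [indicator_faceBox J a b hab]
  rw [integral_finsetSum _ fun s _ => (hi _).const_mul _]
  refine Finset.sum_congr rfl fun s _ => ?_
  rw [integral_const_mul, hint _ measurableSet_Ici]

lemma enorm_toSignedMeasure_sub_faceBox {d : ℕ} {f : (Fin d → I) → ℝ}
    {μ ν : Measure (Fin d → I)} [IsFiniteMeasure μ] [IsFiniteMeasure ν]
    (hf : ∀ t, f t - f 1 = μ.real (Ici t) - ν.real (Ici t)) {J : Finset (Fin d)} (hJ : J.Nonempty)
    {a b : J → I} (hab : a ≤ b) :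
    ‖(μ.toSignedMeasure - ν.toSignedMeasure) (faceBox J a b)‖ₑ =
      ENNReal.ofReal |boxDiff (restrictFace f J) a b| := by
  have h := abs_sum_corners f J a b
  rw [if_pos hJ] at h
  rw [← h, sub_apply, Measure.toSignedMeasure_apply_measurable
    (measurableSet_faceBox J a b), Measure.toSignedMeasure_apply_measurable
    (measurableSet_faceBox J a b), measureReal_faceBox μ J a b hab, measureReal_faceBox ν J a b hab,
    ← Finset.sum_sub_distrib, Real.enorm_eq_ofReal_abs]
  simp_rw [hf, mul_sub]

/-- The points of `[0,1]^d` whose coordinates different from `1` are those in `J`. -/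
def openFace {d : ℕ} (J : Finset (Fin d)) : Set (Fin d → I) :=
  {u | (∀ j ∈ J, u j < 1) ∧ ∀ j ∉ J, u j = 1}

lemma measurableSet_openFace {d : ℕ} (J : Finset (Fin d)) : MeasurableSet (openFace J) := by
  have : openFace J = faceBox J 0 1 := by
    ext u
    simp only [openFace, faceBox, mem_ofPred_eq, Pi.zero_apply, Pi.one_apply, Subtype.forall]
    exact and_congr_left' (forall₂_congr fun j _ => by simp)
  rw [this]
  exact measurableSet_faceBox _ _ _

lemma pairwise_disjoint_openFace {d : ℕ} :
    Pairwise (Function.onFun Disjoint (openFace (d := d))) := by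
  intro J K hJK
  refine disjoint_left.2 fun u hJ hK => hJK ?_
  have key : ∀ {J K : Finset (Fin d)}, u ∈ openFace J → u ∈ openFace K → J ⊆ K := by
    intro J K hJ hK j hj
    by_contra h
    exact (hJ.1 j hj).ne (hK.2 j h)
  exact Finset.Subset.antisymm (key hJ hK) (key hK hJ)

/-- The cells of a partition are disjoint subsets of the open face, and the signed measure of each
is the iterated difference up to sign. -/
lemma vitaliVariation_le_variation_openFace {d : ℕ} {f : (Fin d → I) → ℝ}
    {μ ν : Measure (Fin d → I)} [IsFiniteMeasure μ] [IsFiniteMeasure ν]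
    (hf : ∀ t, f t - f 1 = μ.real (Ici t) - ν.real (Ici t)) {J : Finset (Fin d)}
    (hJ : J.Nonempty) :
    vitaliVariation (restrictFace f J) ≤
      (μ.toSignedMeasure - ν.toSignedMeasure).variation (openFace J) := by
  refine iSup_le fun P => ?_
  set cell : ((j : J) → Fin (P j).size) → Set (Fin d → I) := fun i =>
    faceBox J (fun j => (P j).pts (i j).castSucc) (fun j => (P j).pts (i j).succ)
  have hmeas : ∀ i, MeasurableSet (cell i) := fun i => measurableSet_faceBox _ _ _
  have hdisj : Pairwise (Function.onFun Disjoint cell) := by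
    intro i k hik
    refine disjoint_left.2 fun u hi hk => hik (funext fun j => ?_)
    exact (P j).eq_of_mem_Ico (hi.1 j) (hk.1 j)
  calc _ = ∑ i, ‖(μ.toSignedMeasure - ν.toSignedMeasure) (cell i)‖ₑ := by
        refine Finset.sum_congr rfl fun i _ => ?_
        exact (enorm_toSignedMeasure_sub_faceBox hf hJ
          (fun j => (P j).mono (Fin.castSucc_le_succ _))).symm
    _ ≤ ∑ i, (μ.toSignedMeasure - ν.toSignedMeasure).variation (cell i) :=
        Finset.sum_le_sum fun i _ => VectorMeasure.enorm_measure_le_variation _ _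
    _ = (μ.toSignedMeasure - ν.toSignedMeasure).variation (⋃ i, cell i) := by
        rw [measure_iUnion hdisj hmeas, tsum_fintype]
    _ ≤ _ := by
        refine measure_mono (iUnion_subset fun i u hu => ⟨fun j hj => ?_, hu.2⟩)
        exact (hu.1 ⟨j, hj⟩).2.trans_le unitInterval.le_one'

/-- Distinct open faces are disjoint, so the contributions of the faces add up inside the cube. -/
lemma hardyKrause_le_variation {d : ℕ} {f : (Fin d → I) → ℝ}
    {μ ν : Measure (Fin d → I)} [IsFiniteMeasure μ] [IsFiniteMeasure ν]
    (hf : ∀ t, f t - f 1 = μ.real (Ici t) - ν.real (Ici t)) :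
    hardyKrause f ≤ (μ.toSignedMeasure - ν.toSignedMeasure).variation univ := by
  rw [hardyKrause]
  calc _ ≤ ∑ J : Finset (Fin d) with J.Nonempty,
        (μ.toSignedMeasure - ν.toSignedMeasure).variation (openFace J) :=
        Finset.sum_le_sum fun J hJ =>
          vitaliVariation_le_variation_openFace hf (Finset.mem_filter.1 hJ).2
    _ = (μ.toSignedMeasure - ν.toSignedMeasure).variation
          (⋃ J ∈ Finset.univ.filter fun J : Finset (Fin d) => J.Nonempty, openFace J) :=
        (measure_biUnion_finset (fun J _ K _ h => pairwise_disjoint_openFace h)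
          fun J _ => measurableSet_openFace J).symm
    _ ≤ _ := measure_mono (subset_univ _)

lemma variation_toSignedMeasure_sub_le {X : Type*} [MeasurableSpace X] (μ ν : Measure X)
    [IsFiniteMeasure μ] [IsFiniteMeasure ν] :
    (μ.toSignedMeasure - ν.toSignedMeasure).variation ≤ μ + ν :=
  VectorMeasure.variation_sub_le.trans (by simp)

lemma integral_toSignedMeasure_sub {X : Type*} [MeasurableSpace X] {μ ν : Measure X}
    [IsFiniteMeasure μ] [IsFiniteMeasure ν] {g : X → ℝ} (hμ : Integrable g μ)
    (hν : Integrable g ν) :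
    ∫ᵛ t, g t ∂•(μ.toSignedMeasure - ν.toSignedMeasure) = ∫ t, g t ∂μ - ∫ t, g t ∂ν := by
  -- Real multiplication is symmetric, so the pairing can be flipped to the form in
  -- `VectorMeasure.integral_toSignedMeasure`.
  have hflip : (ContinuousLinearMap.lsmul ℝ ℝ : ℝ →L[ℝ] ℝ →L[ℝ] ℝ) =
      (ContinuousLinearMap.lsmul ℝ ℝ : ℝ →L[ℝ] ℝ →L[ℝ] ℝ).flip := by
    ext; simp
  rw [VectorMeasure.integral_sub_vectorMeasure (by simpa [VectorMeasure.Integrable] using hμ)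
    (by simpa [VectorMeasure.Integrable] using hν), hflip,
    VectorMeasure.integral_toSignedMeasure, VectorMeasure.integral_toSignedMeasure]

/-! ### Transfer to the loss `L` and the dataset -/

lemma Icc_zero_eq_Iic {d : ℕ} (t : Fin d → I) : Icc 0 t = Iic t := by
  ext u; simp only [mem_Icc, mem_Iic, and_iff_right_iff_imp]
  exact fun _ j => unitInterval.nonneg'

lemma Icc_one_eq_Ici {d : ℕ} (t : Fin d → I) : Icc t 1 = Ici t := by
  ext u; simp only [mem_Icc, mem_Ici, and_iff_left_iff_imp]
  exact fun _ j => unitInterval.le_one'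

lemma empiricalError_eq_integral {Z : Type*} {d m : ℕ} {L : Z → ℝ} {T : Z → Fin d → I}
    {f : (Fin d → I) → ℝ} (hf : hardyKrause f < ∞) (hL : ∀ w, L w = f (T w)) (z : Fin m → Z) :
    empiricalError L z = ∫ x, f x ∂(empiricalMeasure fun i => T (z i)) := by
  rw [integral_empiricalMeasure _ (measurable_of_hardyKrause_lt_top f hf), empiricalError]
  simp_rw [hL]

lemma integral_eq_integral_map {Z : Type*} [MeasurableSpace Z] {μ : Measure Z} {d : ℕ} {L : Z → ℝ}
    {T : Z → Fin d → I} {f : (Fin d → I) → ℝ} (hT : Measurable T) (hf : hardyKrause f < ∞)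
    (hL : ∀ w, L w = f (T w)) : ∫ w, L w ∂μ = ∫ x, f x ∂(μ.map T) := by
  rw [integral_map hT.aemeasurable
    (measurable_of_hardyKrause_lt_top f hf).aestronglyMeasurable]
  simp_rw [hL]

lemma integrable_of_factorization {Z : Type*} [MeasurableSpace Z] {μ : Measure Z}
    [IsFiniteMeasure μ] {d : ℕ} {L : Z → ℝ} {T : Z → Fin d → I} {f : (Fin d → I) → ℝ}
    (hT : Measurable T) (hf : hardyKrause f < ∞) (hL : ∀ w, L w = f (T w)) : Integrable L μ := by
  obtain rfl : L = fun w => f (T w) := funext hL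
  exact (integrable_of_hardyKrause_lt_top f hf (μ.map T)).comp_measurable hT

lemma localDiscrepancy_eq {d m : ℕ} (p : Fin m → Fin d → I) (ρ : Measure (Fin d → I))
    (t : Fin d → I) :
    localDiscrepancy p ρ t = (empiricalMeasure p).real (Iic t) - ρ.real (Iic t) := by
  rw [localDiscrepancy, Icc_zero_eq_Iic, empiricalMeasure_real p measurableSet_Iic]

lemma starDiscrepancy_lt_top {d m : ℕ} (hm : 0 < m) (p : Fin m → Fin d → I)
    (ρ : Measure (Fin d → I)) [IsProbabilityMeasure ρ] : starDiscrepancy p ρ < ∞ := by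
  have := isProbabilityMeasure_empiricalMeasure hm p
  refine lt_of_le_of_lt (iSup_le fun t => ?_) ENNReal.one_lt_top
  rw [ENNReal.ofReal_le_one, localDiscrepancy_eq]
  exact abs_sub_le_of_nonneg_of_le measureReal_nonneg measureReal_le_one measureReal_nonneg
    measureReal_le_one

/-- The Koksma–Hlawka bound for the generalization error. -/
lemma ofReal_integral_sub_empiricalError_le {Z : Type*} [MeasurableSpace Z] {μ : Measure Z}
    [IsProbabilityMeasure μ] {d m : ℕ} (hm : 0 < m) {L : Z → ℝ} {T : Z → Fin d → I}
    {f : (Fin d → I) → ℝ} (hT : Measurable T) (hf : hardyKrause f < ∞)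
    (hL : ∀ w, L w = f (T w)) (z : Fin m → Z) :
    ENNReal.ofReal (∫ w, L w ∂μ - empiricalError L z) ≤
      hardyKrause f * starDiscrepancy (fun i => T (z i)) (μ.map T) := by
  have := isProbabilityMeasure_empiricalMeasure hm fun i => T (z i)
  have := Measure.isProbabilityMeasure_map (μ := μ) hT.aemeasurable
  have hD := starDiscrepancy_lt_top hm (fun i => T (z i)) (μ.map T)
  rw [← ENNReal.ofReal_toReal (ENNReal.mul_lt_top hf hD).ne, ENNReal.toReal_mul,
    integral_eq_integral_map hT hf hL, empiricalError_eq_integral hf hL]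
  refine ENNReal.ofReal_le_ofReal ((le_abs_self _).trans
    (abs_integral_sub_integral_le f hf _ _ fun t => ?_))
  rw [← localDiscrepancy_eq, ← ENNReal.ofReal_le_iff_le_toReal hD.ne]
  exact le_iSup (fun t => ENNReal.ofReal |localDiscrepancy (fun i => T (z i)) (μ.map T) t|) t

lemma integral_sub_integral_eq_of_Ici {d : ℕ} {f : (Fin d → I) → ℝ}
    {μ ν : Measure (Fin d → I)} [IsFiniteMeasure μ] [IsFiniteMeasure ν]
    (hf : ∀ t, f t - f 1 = μ.real (Ici t) - ν.real (Ici t))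
    (ρ : Measure (Fin d → I)) [IsProbabilityMeasure ρ] :
    ∫ x, f x ∂ρ = ∫ t, ρ.real (Iic t) ∂μ - ∫ t, ρ.real (Iic t) ∂ν + f 1 := by
  obtain ⟨e1, i1, -⟩ := integral_real_Ici_comp ρ μ measurable_id'
  obtain ⟨e2, i2, -⟩ := integral_real_Ici_comp ρ ν measurable_id'
  have i3 : Integrable (fun x => μ.real (Ici x) - ν.real (Ici x)) ρ := i1.sub i2
  have hf' : ∀ x, f x = μ.real (Ici x) - ν.real (Ici x) + f 1 := fun x => by rw [← hf]; ring
  rw [integral_congr_ae (.of_forall hf'), integral_add i3 (integrable_const _), integral_sub i1 i2,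
    e1, e2]
  simp [Iic]

end AnalyticalLearning

theorem theorem1 {Z : Type*} [MeasurableSpace Z] (μ : Measure Z) [IsProbabilityMeasure μ]
    (d m : ℕ) (hm : 0 < m) (z : Fin m → Z) (L : Z → ℝ) :
    -- the expected error is a genuine integral as soon as a factorization exists
    ((AnalyticalLearning.factorizations d L).Nonempty → Integrable L μ) ∧
    -- (i)
    ((∫ w, L w ∂μ : ℝ) : EReal) ≤ ((AnalyticalLearning.empiricalError L z : ℝ) : EReal) +
      ((⨅ p ∈ AnalyticalLearning.factorizations d L,
        AnalyticalLearning.hardyKrause p.2 *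
          AnalyticalLearning.starDiscrepancy (fun i => p.1 (z i)) (μ.map p.1) : ℝ≥0∞) : EReal) ∧
    -- (ii)
    ∀ (T : Z → Fin d → I) (f : (Fin d → I) → ℝ),
      (T, f) ∈ AnalyticalLearning.factorizations d L →
      AnalyticalLearning.LeftContinuousComponentwise f →
      ∃ ν : SignedMeasure (Fin d → I),
        (∀ t, f t = ν (Icc t 1) + f 1) ∧
        ν.variation univ = AnalyticalLearning.hardyKrause f ∧
        ν.Integrable (fun t => (μ.map T).real (Icc 0 t) -
          AnalyticalLearning.empiricalFraction (fun i => T (z i)) (Icc 0 t)) ∧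
        ∫ w, L w ∂μ = AnalyticalLearning.empiricalError L z +
          ∫ᵛ t, ((μ.map T).real (Icc 0 t) -
            AnalyticalLearning.empiricalFraction (fun i => T (z i)) (Icc 0 t)) ∂•ν := by
  open AnalyticalLearning in
  refine ⟨?_, ?_, ?_⟩
  · rintro ⟨⟨T, f⟩, hT, hf, hL⟩
    exact integrable_of_factorization hT hf hL
  -- Truncating the generalization gap at 0 allows the infimum to be taken in `ℝ≥0∞`, where it is ∞
  -- if there is no factorization.
  · have h : ENNReal.ofReal (∫ w, L w ∂μ - empiricalError L z) ≤
        ⨅ p ∈ factorizations d L,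
          hardyKrause p.2 * starDiscrepancy (fun i => p.1 (z i)) (μ.map p.1) :=
      le_iInf₂ fun p hp => ofReal_integral_sub_empiricalError_le hm hp.1 hp.2.1 hp.2.2 z
    refine le_trans ?_ (add_le_add_right (EReal.coe_ennreal_le_coe_ennreal_iff.2 h) _)
    rw [EReal.coe_ennreal_ofReal, ← EReal.coe_add, EReal.coe_le_coe_iff]
    linarith [le_max_left (∫ w, L w ∂μ - empiricalError L z) 0]
  · intro T f hTf hlc
    obtain ⟨hT, hf, hL⟩ : Measurable T ∧ hardyKrause f < ∞ ∧ ∀ w, L w = f (T w) := hTf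
    obtain ⟨η, ν, hV, hην⟩ := exists_measures_of_leftContinuous f hf hlc
    have := isProbabilityMeasure_empiricalMeasure hm fun i => T (z i)
    have := Measure.isProbabilityMeasure_map (μ := μ) hT.aemeasurable
    have hg : (fun t => (μ.map T).real (Icc 0 t) - empiricalFraction (fun i => T (z i)) (Icc 0 t)) =
        fun t => (μ.map T).real (Iic t) - (empiricalMeasure fun i => T (z i)).real (Iic t) := by
      funext t
      rw [Icc_zero_eq_Iic, empiricalMeasure_real _ measurableSet_Iic]
    have hi : ∀ (ρ : Measure (Fin d → I)) [IsProbabilityMeasure ρ] (κ : Measure (Fin d → I))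
        [IsFiniteMeasure κ], Integrable (fun t => ρ.real (Iic t)) κ := fun ρ _ κ _ =>
      (integral_real_Ici_comp ρ κ measurable_id').2.2
    have hvar := variation_toSignedMeasure_sub_le (η : Measure (Fin d → I)) (ν : Measure (Fin d → I))
    refine ⟨(η : Measure (Fin d → I)).toSignedMeasure - (ν : Measure (Fin d → I)).toSignedMeasure,
      fun t => ?_, le_antisymm ((hvar univ).trans hV) (hardyKrause_le_variation hην), ?_, ?_⟩
    · rw [sub_apply, Icc_one_eq_Ici,
        Measure.toSignedMeasure_apply_measurable measurableSet_Ici,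
        Measure.toSignedMeasure_apply_measurable measurableSet_Ici, ← hην, sub_add_cancel]
    · rw [hg]
      exact ((hi _ _).sub (hi _ _)).mono_measure hvar
    · have e : ∀ (κ : Measure (Fin d → I)) [IsFiniteMeasure κ], _ := fun κ _ =>
        integral_sub (hi (μ.map T) κ) (hi (empiricalMeasure fun i => T (z i)) κ)
      have hi' : ∀ (κ : Measure (Fin d → I)) [IsFiniteMeasure κ], Integrable (fun t =>
          (μ.map T).real (Iic t) - (empiricalMeasure fun i => T (z i)).real (Iic t)) κ := fun κ _ =>
        (hi _ κ).sub (hi _ κ)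
      -- Subtracting the Fubini formulas for T_*μ and the empirical measure cancels `f 1`.
      rw [hg, integral_toSignedMeasure_sub (hi' _) (hi' _), e, e,
        integral_eq_integral_map hT hf hL, empiricalError_eq_integral hf hL,
        integral_sub_integral_eq_of_Ici hην (μ.map T), integral_sub_integral_eq_of_Ici hην]
      ring
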